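/- Let $\mathcal L_0$ be the propositional language with connectives $\wedge,\vee,\to,\bot$ over a finite set $\mathsf{var}$ of variables and a finite set $\mathsf{par}$ of parameters (disjoint; together, the atoms), with $\top:=\bot\to\bot$. Let $\vdash$ denote derivability in intuitionistic propositional logic. Substitutions commute with all connectives and are the identity on parameters; $(\theta\tau)(B)=\theta(\tau(B))$. Kripke models are finite rooted trees with a persistent valuation of the atoms, and $\mathcal K\Vdash A$ means that $A$ is forced at every node of $\mathcal K$. $\mathsf{NI}$ is the set of formulas without implications. $\mathsf{NNIL}$ is the least set that contains the atoms and $\bot$, is closed under $\wedge$ and $\vee$, and contains $B\to C$ whenever $B\in\mathsf{NI}$ and $C\in\mathsf{NNIL}$. $\mathsf{NNIL}(\mathsf{par})$ is the set of $\mathsf{NNIL}$ formulas all of whose atoms are parameters; up to provable equivalence it is finite. For $\Gamma\subseteq\mathcal L_0$, a substitution $\theta$ *projects $A$ to $\Gamma$* if $A\vdash a\leftrightarrow\theta(a)$ for every atom $a$ and $\vdash\theta(A)\leftrightarrow A'$ for some $A'\in\Gamma$. The formula $A$ is *$\Gamma$-projective* if some substitution projects $A$ to $\Gamma$. The formula $A$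 is *$\mathsf{par}$-extendible* if the following holds for every model $\mathcal K\Vdash A$. Let $\mathcal K'$ be a model whose nodes form a subset of those of $\mathcal K$ with the restricted order, whose valuation agrees there with that of $\mathcal K$ on parameters (and is arbitrary, but persistent, on variables), and in which $A$ is forced at every node other than the root. Then there is a model $\mathcal K''\Vdash A$ with the same frame as $\mathcal K'$ and the same valuation, except possibly for variables at the root. For $\mathbf x\subseteq\mathsf{var}$ let $\theta_A^{\mathbf x}$ be the substitution with $\theta_A^{\mathbf x}(y)=A\to y$ for $y\in\mathbf x$ and $\theta_A^{\mathbf x}(y)=A\wedge y$ for $y\in\mathsf{var}\setminus\mathbf x$. Let $\mathbf x_1,\dots,\mathbf x_s$ be any list of all subsets of $\mathsf{var}$ such that $\mathbf x_i\subseteq\mathbf x_j$ implies $i\le j$, and put $\theta_A:=\theta_A^{\mathbf x_s}\theta_A^{\mathbf x_{s-1}}\cdots\theta_A^{\mathbf x_1}$. Finally, let $$A^\dagger:=\bigwedge_{\mathbf p\subseteq\mathsf{par}}\Bigl(\bigwedge\mathbf p\to\bigvee_{\mathcal K\Vdash\mathbf p,A}\ \bigwedge\{B\in\mathsf{NNIL}(\mathsf{par}):\mathcal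 K\Vdash B\}\Bigr),$$ where formulas of $\mathsf{NNIL}(\mathsf{par})$ are taken modulo provable equivalence, so that the conjunctions and the disjunction are finite; an empty disjunction is $\bot$ and an empty conjunction is $\top$. **Theorem.** For every $A\in\mathcal L_0$ the following are equivalent: 1. $\theta_A$ projects $A$ to $\{A^\dagger\}$; 2. $A$ is $\mathsf{NNIL}(\mathsf{par})$-projective; 3. $A$ is $\mathsf{par}$-extendible. -/

import Mathlib

namespace RelUnif

/-! ## The propositional language -/

/-- Formulas of propositional logic over a type `α` of atoms. -/
inductive Formula (α : Type*) where
  | atom : α → Formula α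
  | bot : Formula α
  | and : Formula α → Formula α → Formula α
  | or : Formula α → Formula α → Formula α
  | imp : Formula α → Formula α → Formula α

namespace Formula

variable {α : Type*}

/-- `⊤ := ⊥ → ⊥`. -/
def top : Formula α := imp bot bot

/-- `A ↔ B`. -/
def iff (A B : Formula α) : Formula α := and (imp A B) (imp B A)

/-- Conjunction of a finite list of formulas; the empty conjunction is `⊤`. -/
def listConj : List (Formula α) → Formula α
  | [] => top
  | A :: l => and A (listConj l)

/-- Disjunction of a finite list of formulas; the empty disjunction is `⊥`. -/
def listDisj : List (Formula α) → Formula α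
  | [] => bot
  | A :: l => or A (listDisj l)

/-- `⋀_{i ∈ s} F i`, for a finite set `s` (listed in an arbitrary order). -/
noncomputable def bigConj {ι : Type*} (s : Finset ι) (F : ι → Formula α) : Formula α :=
  listConj (s.toList.map F)

/-- `⋁_{i ∈ s} F i`, for a finite set `s` (listed in an arbitrary order). -/
noncomputable def bigDisj {ι : Type*} (s : Finset ι) (F : ι → Formula α) : Formula α :=
  listDisj (s.toList.map F)

/-- `A ∈ L₀(X)`: every atom that occurs in `A` belongs to `X`. -/
def InLang (X : Set α) : Formula α → Prop
  | atom a => a ∈ X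
  | bot => True
  | and A B => InLang X A ∧ InLang X B
  | or A B => InLang X A ∧ InLang X B
  | imp A B => InLang X A ∧ InLang X B

/-- `NI`: no implications. -/
inductive NI : Formula α → Prop
  | atom (a : α) : NI (atom a)
  | bot : NI bot
  | and {A B : Formula α} : NI A → NI B → NI (and A B)
  | or {A B : Formula α} : NI A → NI B → NI (or A B)

/-- `NNIL`: no nested implications on the left. -/
inductive NNIL : Formula α → Prop
  | atom (a : α) : NNIL (atom a)
  | bot : NNIL bot
  | and {A B : Formula α} : NNIL A → NNIL B → NNIL (and A B)
  | or {A B : Formula α} : NNIL A → NNIL B → NNIL (or A B)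
  | imp {A B : Formula α} : NI A → NNIL B → NNIL (imp A B)

/-- `NNIL(X) = NNIL ∩ L₀(X)`. -/
def NNILOver (X : Set α) : Set (Formula α) := {A | NNIL A ∧ InLang X A}

end Formula

/-! ## Intuitionistic propositional logic, by natural deduction -/

/-- `IPC Γ A`: the formula `A` is derivable from the set `Γ` in intuitionistic logic. -/
inductive IPC {α : Type*} : Set (Formula α) → Formula α → Prop
  | ax {Γ : Set (Formula α)} {A : Formula α} : A ∈ Γ → IPC Γ A
  | botE {Γ : Set (Formula α)} {A : Formula α} : IPC Γ Formula.bot → IPC Γ A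
  | andI {Γ : Set (Formula α)} {A B : Formula α} :
      IPC Γ A → IPC Γ B → IPC Γ (Formula.and A B)
  | andE₁ {Γ : Set (Formula α)} {A B : Formula α} : IPC Γ (Formula.and A B) → IPC Γ A
  | andE₂ {Γ : Set (Formula α)} {A B : Formula α} : IPC Γ (Formula.and A B) → IPC Γ B
  | orI₁ {Γ : Set (Formula α)} {A B : Formula α} : IPC Γ A → IPC Γ (Formula.or A B)
  | orI₂ {Γ : Set (Formula α)} {A B : Formula α} : IPC Γ B → IPC Γ (Formula.or A B)
  | orE {Γ : Set (Formula α)} {A B C : Formula α} : IPC Γ (Formula.or A B) →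
      IPC (insert A Γ) C → IPC (insert B Γ) C → IPC Γ C
  | impI {Γ : Set (Formula α)} {A B : Formula α} :
      IPC (insert A Γ) B → IPC Γ (Formula.imp A B)
  | impE {Γ : Set (Formula α)} {A B : Formula α} :
      IPC Γ (Formula.imp A B) → IPC Γ A → IPC Γ B

/-- `⊢ A ↔ B`. -/
def Equivalent {α : Type*} (A B : Formula α) : Prop := IPC ∅ (Formula.iff A B)

/-! ## `NNIL(X)` is finite up to provable equivalence, for finite `X`

The proof takes place in the Lindenbaum algebra. -/

section Finiteness

variable {α : Type*}

theorem IPC.weaken {Γ Δ : Set (Formula α)} {A : Formula α} (h : IPC Γ A) (hs : Γ ⊆ Δ) :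
    IPC Δ A := by
  induction h generalizing Δ with
  | ax h => exact .ax (hs h)
  | botE _ ih => exact .botE (ih hs)
  | andI _ _ ih₁ ih₂ => exact .andI (ih₁ hs) (ih₂ hs)
  | andE₁ _ ih => exact .andE₁ (ih hs)
  | andE₂ _ ih => exact .andE₂ (ih hs)
  | orI₁ _ ih => exact .orI₁ (ih hs)
  | orI₂ _ ih => exact .orI₂ (ih hs)
  | orE _ _ _ ih₁ ih₂ ih₃ =>
    exact .orE (ih₁ hs) (ih₂ (Set.insert_subset_insert hs)) (ih₃ (Set.insert_subset_insert hs))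
  | impI _ ih => exact .impI (ih (Set.insert_subset_insert hs))
  | impE _ _ ih₁ ih₂ => exact .impE (ih₁ hs) (ih₂ hs)

theorem IPC.cut {Γ : Set (Formula α)} {A B : Formula α} (h : IPC {A} B) (hA : IPC Γ A) :
    IPC Γ B :=
  .impE (.impI (h.weaken (by simp))) hA

theorem equivalent_iff {A B : Formula α} : Equivalent A B ↔ IPC {A} B ∧ IPC {B} A := by
  constructor
  · intro h
    exact ⟨.impE ((IPC.andE₁ h).weaken (Set.empty_subset _)) (.ax rfl),
      .impE ((IPC.andE₂ h).weaken (Set.empty_subset _)) (.ax rfl)⟩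
  · rintro ⟨h₁, h₂⟩
    exact .andI (.impI (h₁.weaken (by simp))) (.impI (h₂.weaken (by simp)))

/-- Provable equivalence as a setoid. -/
def lindSetoid (α : Type*) : Setoid (Formula α) where
  r := Equivalent
  iseqv := by
    constructor
    · intro A
      exact equivalent_iff.2 ⟨.ax rfl, .ax rfl⟩
    · intro A B h
      exact equivalent_iff.2 (equivalent_iff.1 h).symm
    · intro A B C h₁ h₂
      rw [equivalent_iff] at *
      exact ⟨h₂.1.cut h₁.1, h₁.2.cut h₂.2⟩

/-- The Lindenbaum algebra of `IPC`. -/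
def Lind (α : Type*) : Type _ := Quotient (lindSetoid α)

/-- The class of a formula in the Lindenbaum algebra. -/
def cls (A : Formula α) : Lind α := Quotient.mk (lindSetoid α) A

theorem cls_eq {A B : Formula α} : cls A = cls B ↔ Equivalent A B :=
  ⟨fun h => Quotient.exact h, fun h => Quotient.sound (s := lindSetoid α) h⟩

theorem exists_cls (h : Lind α) : ∃ A, cls A = h := Quotient.exists_rep h

instance : LE (Lind α) where
  le := Quotient.lift₂ (fun A B => IPC {A} B) (by
    intro A B A' B' hA hB
    have hA' := equivalent_iff.1 hA
    have hB' := equivalent_iff.1 hB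
    exact propext ⟨fun h => hB'.1.cut (h.cut hA'.2), fun h => hB'.2.cut (h.cut hA'.1)⟩)

theorem cls_le {A B : Formula α} : cls A ≤ cls B ↔ IPC {A} B := Iff.rfl

instance : PartialOrder (Lind α) where
  le_refl a := by
    obtain ⟨A, rfl⟩ := exists_cls a
    exact .ax rfl
  le_trans a b c := by
    obtain ⟨A, rfl⟩ := exists_cls a
    obtain ⟨B, rfl⟩ := exists_cls b
    obtain ⟨C, rfl⟩ := exists_cls c
    exact fun h₁ h₂ => IPC.cut h₂ h₁
  le_antisymm a b := by
    obtain ⟨A, rfl⟩ := exists_cls a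
    obtain ⟨B, rfl⟩ := exists_cls b
    exact fun h₁ h₂ => cls_eq.2 (equivalent_iff.2 ⟨h₁, h₂⟩)

theorem ipc_or {A B C : Formula α} (h₁ : IPC {A} C) (h₂ : IPC {B} C) :
    IPC {Formula.or A B} C :=
  .orE (.ax rfl) (h₁.weaken (by simp)) (h₂.weaken (by simp))

theorem ipc_imp {A B C : Formula α} : IPC {A} (Formula.imp B C) ↔ IPC {Formula.and A B} C := by
  constructor
  · intro h
    exact .impE (h.cut (.andE₁ (.ax rfl))) (.andE₂ (.ax rfl))
  · intro h
    exact .impI (h.cut (.andI (.ax (by simp)) (.ax (by simp))))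

noncomputable instance : HeytingAlgebra (Lind α) where
  sup := Quotient.map₂ Formula.or (by
    intro A A' hA B B' hB
    have hA' := equivalent_iff.1 hA
    have hB' := equivalent_iff.1 hB
    exact equivalent_iff.2 ⟨ipc_or (.orI₁ hA'.1) (.orI₂ hB'.1), ipc_or (.orI₁ hA'.2) (.orI₂ hB'.2)⟩)
  inf := Quotient.map₂ Formula.and (by
    intro A A' hA B B' hB
    have hA' := equivalent_iff.1 hA
    have hB' := equivalent_iff.1 hB
    exact equivalent_iff.2
      ⟨.andI (hA'.1.cut (.andE₁ (.ax rfl))) (hB'.1.cut (.andE₂ (.ax rfl))),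
        .andI (hA'.2.cut (.andE₁ (.ax rfl))) (hB'.2.cut (.andE₂ (.ax rfl)))⟩)
  himp := Quotient.map₂ Formula.imp (by
    intro A A' hA B B' hB
    have hA' := equivalent_iff.1 hA
    have hB' := equivalent_iff.1 hB
    exact equivalent_iff.2
      ⟨.impI (hB'.1.cut (.impE (.ax (by simp)) (hA'.2.cut (.ax (by simp))))),
        .impI (hB'.2.cut (.impE (.ax (by simp)) (hA'.1.cut (.ax (by simp)))))⟩)
  top := cls Formula.top
  bot := cls Formula.bot
  compl := Quotient.map (fun A => Formula.imp A Formula.bot) (by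
    intro A A' hA
    have hA' := equivalent_iff.1 hA
    exact equivalent_iff.2
      ⟨.impI (.impE (A := A) (.ax (by simp)) (hA'.2.cut (.ax (by simp)))),
        .impI (.impE (A := A') (.ax (by simp)) (hA'.1.cut (.ax (by simp))))⟩)
  le_sup_left a b := by
    obtain ⟨A, rfl⟩ := exists_cls a
    obtain ⟨B, rfl⟩ := exists_cls b
    exact IPC.orI₁ (.ax rfl)
  le_sup_right a b := by
    obtain ⟨A, rfl⟩ := exists_cls a
    obtain ⟨B, rfl⟩ := exists_cls b
    exact IPC.orI₂ (.ax rfl)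
  sup_le a b c := by
    obtain ⟨A, rfl⟩ := exists_cls a
    obtain ⟨B, rfl⟩ := exists_cls b
    obtain ⟨C, rfl⟩ := exists_cls c
    exact fun h₁ h₂ => ipc_or h₁ h₂
  inf_le_left a b := by
    obtain ⟨A, rfl⟩ := exists_cls a
    obtain ⟨B, rfl⟩ := exists_cls b
    exact IPC.andE₁ (.ax rfl)
  inf_le_right a b := by
    obtain ⟨A, rfl⟩ := exists_cls a
    obtain ⟨B, rfl⟩ := exists_cls b
    exact IPC.andE₂ (.ax rfl)
  le_inf a b c := by
    obtain ⟨A, rfl⟩ := exists_cls a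
    obtain ⟨B, rfl⟩ := exists_cls b
    obtain ⟨C, rfl⟩ := exists_cls c
    exact fun h₁ h₂ => IPC.andI h₁ h₂
  le_top a := by
    obtain ⟨A, rfl⟩ := exists_cls a
    exact IPC.impI (.ax (by simp))
  bot_le a := by
    obtain ⟨A, rfl⟩ := exists_cls a
    exact IPC.botE (.ax rfl)
  le_himp_iff a b c := by
    obtain ⟨A, rfl⟩ := exists_cls a
    obtain ⟨B, rfl⟩ := exists_cls b
    obtain ⟨C, rfl⟩ := exists_cls c
    exact ipc_imp
  himp_bot a := by
    obtain ⟨A, rfl⟩ := exists_cls a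
    rfl

theorem cls_and (A B : Formula α) : cls (Formula.and A B) = cls A ⊓ cls B := rfl

theorem cls_or (A B : Formula α) : cls (Formula.or A B) = cls A ⊔ cls B := rfl

theorem cls_imp (A B : Formula α) : cls (Formula.imp A B) = cls A ⇨ cls B := rfl

theorem cls_bot : cls (Formula.bot : Formula α) = ⊥ := rfl

theorem cls_top : cls (Formula.top : Formula α) = ⊤ := rfl

theorem himp_inf_le_of_inf_eq {H : Type*} [HeytingAlgebra H] {a a' c c' p : H}
    (ha : a ⊓ p = a' ⊓ p) (hc : c ⊓ p = c' ⊓ p) : (a ⇨ c) ⊓ p ≤ (a' ⇨ c') ⊓ p := by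
  refine le_inf (le_himp_iff.2 ?_) inf_le_right
  calc (a ⇨ c) ⊓ p ⊓ a' = (a ⇨ c) ⊓ (a' ⊓ p) := by rw [inf_assoc, inf_comm p]
    _ = (a ⇨ c) ⊓ a ⊓ p := by rw [← ha, inf_assoc]
    _ ≤ c ⊓ p := inf_le_inf_right _ himp_inf_le
    _ ≤ c' := by rw [hc]; exact inf_le_left

theorem ni_eliminate {X : Set α} (p : α) {A : Formula α} (hA : A.NI) (hX : A.InLang X) :
    cls (.atom p) ≤ cls A ∨ ∃ A' : Formula α, A'.NI ∧ A'.InLang (X \ {p}) ∧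
      cls A ⊓ cls (.atom p) = cls A' ⊓ cls (.atom p) := by
  induction hA with
  | atom a =>
    by_cases h : a = p
    · exact .inl (h ▸ le_rfl)
    · exact .inr ⟨_, .atom a, ⟨hX, h⟩, rfl⟩
  | bot => exact .inr ⟨_, .bot, trivial, rfl⟩
  | and _ _ ih₁ ih₂ =>
    rw [cls_and]
    rcases ih₁ hX.1 with h₁ | ⟨A', n₁, l₁, e₁⟩ <;> rcases ih₂ hX.2 with h₂ | ⟨B', n₂, l₂, e₂⟩
    · exact .inl (le_inf h₁ h₂)
    · refine .inr ⟨B', n₂, l₂, ?_⟩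
      rw [inf_assoc, e₂, inf_eq_right]
      exact inf_le_right.trans h₁
    · refine .inr ⟨A', n₁, l₁, ?_⟩
      rw [inf_assoc, inf_eq_right.2 h₂, e₁]
    · refine .inr ⟨_, n₁.and n₂, ⟨l₁, l₂⟩, ?_⟩
      rw [cls_and, inf_inf_distrib_right, e₁, e₂, ← inf_inf_distrib_right]
  | or _ _ ih₁ ih₂ =>
    rw [cls_or]
    rcases ih₁ hX.1 with h₁ | ⟨A', n₁, l₁, e₁⟩
    · exact .inl (h₁.trans le_sup_left)
    · rcases ih₂ hX.2 with h₂ | ⟨B', n₂, l₂, e₂⟩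
      · exact .inl (h₂.trans le_sup_right)
      · refine .inr ⟨_, n₁.or n₂, ⟨l₁, l₂⟩, ?_⟩
        rw [cls_or, inf_sup_right, e₁, e₂, ← inf_sup_right]

theorem nnil_eliminate {X : Set α} (p : α) {A : Formula α} (hA : A.NNIL) (hX : A.InLang X) :
    ∃ A' : Formula α, A'.NNIL ∧ A'.InLang (X \ {p}) ∧
      cls A ⊓ cls (.atom p) = cls A' ⊓ cls (.atom p) := by
  induction hA with
  | atom a =>
    by_cases h : a = p
    · refine ⟨Formula.top, .imp .bot .bot, ⟨trivial, trivial⟩, ?_⟩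
      rw [h, cls_top, inf_idem, top_inf_eq]
    · exact ⟨_, .atom a, ⟨hX, h⟩, rfl⟩
  | bot => exact ⟨_, .bot, trivial, rfl⟩
  | and _ _ ih₁ ih₂ =>
    obtain ⟨A', n₁, l₁, e₁⟩ := ih₁ hX.1
    obtain ⟨B', n₂, l₂, e₂⟩ := ih₂ hX.2
    refine ⟨_, n₁.and n₂, ⟨l₁, l₂⟩, ?_⟩
    rw [cls_and, cls_and, inf_inf_distrib_right, e₁, e₂, ← inf_inf_distrib_right]
  | or _ _ ih₁ ih₂ =>
    obtain ⟨A', n₁, l₁, e₁⟩ := ih₁ hX.1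
    obtain ⟨B', n₂, l₂, e₂⟩ := ih₂ hX.2
    refine ⟨_, n₁.or n₂, ⟨l₁, l₂⟩, ?_⟩
    rw [cls_or, cls_or, inf_sup_right, e₁, e₂, ← inf_sup_right]
  | imp hN _ ih =>
    obtain ⟨B', n₂, l₂, e₂⟩ := ih hX.2
    rcases ni_eliminate p hN hX.1 with h | ⟨A', n₁, l₁, e₁⟩
    · refine ⟨B', n₂, l₂, ?_⟩
      rw [cls_imp, ← e₂]
      exact le_antisymm
        (le_inf ((inf_le_inf_left _ h).trans himp_inf_le) inf_le_right)
        (inf_le_inf_right _ le_himp)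
    · refine ⟨_, n₂.imp n₁, ⟨l₁, l₂⟩, ?_⟩
      exact le_antisymm (himp_inf_le_of_inf_eq e₁ e₂) (himp_inf_le_of_inf_eq e₁.symm e₂.symm)

/-- For finite `X`, the set `NNIL(X)` is finite up to provable equivalence. -/
theorem nnilOver_finite (n : ℕ) (X : Set α) (hX : X.Finite) (hn : X.ncard = n) :
    (cls '' Formula.NNILOver X).Finite := by
  induction n using Nat.strong_induction_on generalizing X with
  | _ n ih =>
    set T : Set (Lind α) := {⊥, ⊤} ∪ (fun a => cls (.atom a)) '' X ∪
      ⋃ p ∈ X, (fun h => cls (.atom p) ⇨ h) '' (cls '' Formula.NNILOver (X \ {p})) with hT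
    have hfin : T.Finite := by
      refine ((Set.toFinite _).union (hX.image _)).union (hX.biUnion fun p hp => ?_)
      refine Set.Finite.image _ (ih _ ?_ _ hX.sdiff rfl)
      rw [← hn]
      exact Set.ncard_sdiff_singleton_lt_of_mem hp hX
    refine hfin.latticeClosure.subset ?_
    have hsub : T ⊆ latticeClosure T := subset_latticeClosure
    have hlat : IsSublattice (latticeClosure T) := isSublattice_latticeClosure
    have hatom : ∀ a ∈ X, cls (.atom a) ∈ latticeClosure T := fun a ha =>
      hsub (.inl (.inr ⟨a, ha, rfl⟩))
    have hbot : (⊥ : Lind α) ∈ latticeClosure T := hsub (.inl (.inl (by simp)))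
    have htop : (⊤ : Lind α) ∈ latticeClosure T := hsub (.inl (.inl (by simp)))
    rintro _ ⟨A, ⟨hA, hl⟩, rfl⟩
    induction hA with
    | atom a => exact hatom a hl
    | bot => exact hbot
    | and _ _ ih₁ ih₂ => exact hlat.infClosed (ih₁ hl.1) (ih₂ hl.2)
    | or _ _ ih₁ ih₂ => exact hlat.supClosed (ih₁ hl.1) (ih₂ hl.2)
    | @imp A B hN hB ihB =>
      have key : ∀ C : Formula α, C.NNIL → C.InLang X → cls C ∈ latticeClosure T →
          cls A ⇨ cls C ∈ latticeClosure T := by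
        have hlA : A.InLang X := hl.1
        clear hl ihB hB
        induction hN with
        | atom p =>
          intro C hC hlC _
          obtain ⟨C', n, l, e⟩ := nnil_eliminate p hC hlC
          refine hsub (.inr (Set.mem_biUnion hlA ⟨cls C', ⟨C', ⟨n, l⟩, rfl⟩, ?_⟩))
          have h : ∀ D : Formula α,
              cls (.atom p) ⇨ cls D = cls (.atom p) ⇨ (cls D ⊓ cls (.atom p)) := fun D => by
            rw [himp_inf_distrib, himp_self, inf_top_eq]
          change cls (.atom p) ⇨ cls C' = cls (.atom p) ⇨ cls C
          rw [h C, h C', e]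
        | bot =>
          intro C _ _ _
          rw [cls_bot, bot_himp]
          exact htop
        | and n₁ n₂ ih₁ ih₂ =>
          intro C hC hlC hmem
          rw [cls_and, ← himp_himp]
          exact ih₁ hlA.1 (.imp _ C) (.imp n₂ hC) ⟨hlA.2, hlC⟩ (ih₂ hlA.2 C hC hlC hmem)
        | or _ _ ih₁ ih₂ =>
          intro C hC hlC hmem
          rw [cls_or, sup_himp_distrib]
          exact hlat.infClosed (ih₁ hlA.1 C hC hlC hmem) (ih₂ hlA.2 C hC hlC hmem)
      exact key B hB hl.2 (ihB hl.2)

/-- For finite `X` there are finitely many formulas in `NNIL(X)` such that every formula of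
`NNIL(X)` is provably equivalent to one of them. -/
theorem exists_nnilReps {X : Set α} (hX : X.Finite) :
    ∃ N : Finset (Formula α), (∀ B ∈ N, B ∈ Formula.NNILOver X) ∧
      ∀ B ∈ Formula.NNILOver X, ∃ C ∈ N, Equivalent B C := by
  classical
  have h := nnilOver_finite _ X hX rfl
  obtain ⟨N, hN, e⟩ := Finset.subset_set_image_iff.1 (h.coe_toFinset.subset)
  refine ⟨N, fun B hB => hN hB, fun B hB => ?_⟩
  have hB' : cls B ∈ N.image cls := by
    rw [e, h.mem_toFinset]
    exact ⟨B, hB, rfl⟩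
  obtain ⟨C, hC, hCB⟩ := Finset.mem_image.1 hB'
  exact ⟨C, hC, cls_eq.1 hCB.symm⟩

end Finiteness

/-- A finite set of representatives of `NNIL(X)` modulo provable equivalence, for finite `X`. -/
noncomputable def nnilReps {α : Type*} (X : Set α) (hX : X.Finite) : Finset (Formula α) :=
  (exists_nnilReps hX).choose

/-! ## Kripke models: finite rooted trees -/

/-- A finite rooted tree. -/
structure Frame where
  /-- The set of worlds. -/
  W : Type
  [order : PartialOrder W]
  [finite : Finite W]
  /-- The root. -/
  root : W
  root_le : ∀ w, root ≤ w
  tree : ∀ w u v : W, u ≤ w → v ≤ w → u ≤ v ∨ v ≤ u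

attribute [instance] Frame.order Frame.finite

/-- A Kripke model on the frame `F`, given by its persistent valuation of the atoms. -/
structure Model (F : Frame) (α : Type*) where
  /-- `V w a`: the atom `a` is true at `w`. -/
  V : F.W → α → Prop
  mono : ∀ {w u : F.W} {a : α}, w ≤ u → V w a → V u a

namespace Model

variable {α : Type*} {F : Frame}

/-- `K, w ⊩ A`. -/
def Forces (K : Model F α) : F.W → Formula α → Prop
  | w, .atom a => K.V w a
  | _, .bot => False
  | w, .and A B => K.Forces w A ∧ K.Forces w B
  | w, .or A B => K.Forces w A ∨ K.Forces w B
  | w, .imp A B => ∀ u, w ≤ u → K.Forces u A → K.Forces u B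

/-- `K ⊩ A`: the formula `A` is forced at every world. -/
def Valid (K : Model F α) (A : Formula α) : Prop := ∀ w, K.Forces w A

/-- `K ⊩⁻ A`: the formula `A` is forced at every world other than the root. -/
def ValidAboveRoot (K : Model F α) (A : Formula α) : Prop := ∀ w, w ≠ F.root → K.Forces w A

/-- `K'` is (isomorphic to) a model on a subset of the worlds of `K`, with the restricted order,
whose valuation agrees with that of `K` on the atoms in `X` (other atoms are unconstrained). -/
def IsSubmodel {F' : Frame} (X : Set α) (K' : Model F' α) (K : Model F α) : Prop :=
  ∃ f : F'.W ↪o F.W, ∀ w, ∀ a ∈ X, (K'.V w a ↔ K.V (f w) a)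

/-- `K''` is an `X`-variant of `K'`: same frame, and same valuation except possibly at the root
and there only for atoms outside `X`. -/
def IsVariant (X : Set α) (K'' K' : Model F α) : Prop :=
  ∀ w a, (w ≠ F.root ∨ a ∈ X) → (K''.V w a ↔ K'.V w a)

end Model

/-- `A` is `X`-extendible. -/
def Extendible {α : Type*} (X : Set α) (A : Formula α) : Prop :=
  ∀ (F : Frame) (K : Model F α), K.Valid A →
    ∀ (F' : Frame) (K' : Model F' α), K'.IsSubmodel X K → K'.ValidAboveRoot A →
      ∃ K'' : Model F' α, K''.IsVariant X K' ∧ K''.Valid A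

/-! ## Variables, parameters and substitutions

From here on the atoms are variables (from a finite type `Var`) and parameters (from a finite type
`Par`), that is, elements of `Var ⊕ Par`. -/

section Projectivity

variable {Var Par : Type*}

/-- The set `par` of parameters, as a set of atoms. -/
def parAtoms (Var Par : Type*) : Set (Var ⊕ Par) := Set.range Sum.inr

/-- A substitution, given by its values on the variables; it fixes the parameters. -/
def Subst (Var Par : Type*) : Type _ := Var → Formula (Var ⊕ Par)

namespace Subst

/-- `θ(A)`. -/
def apply (θ : Subst Var Par) : Formula (Var ⊕ Par) → Formula (Var ⊕ Par)
  | .atom (.inl x) => θ x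
  | .atom (.inr p) => .atom (.inr p)
  | .bot => .bot
  | .and A B => .and (θ.apply A) (θ.apply B)
  | .or A B => .or (θ.apply A) (θ.apply B)
  | .imp A B => .imp (θ.apply A) (θ.apply B)

/-- The identity substitution. -/
def id : Subst Var Par := fun x => .atom (.inl x)

/-- The composition `θτ`, that is, `A ↦ θ(τ(A))`. -/
def comp (θ τ : Subst Var Par) : Subst Var Par := fun x => θ.apply (τ x)

/-- `θ` is `A`-projective: `A ⊢ a ↔ θ(a)` for every atom `a`. -/
def IsProjective (A : Formula (Var ⊕ Par)) (θ : Subst Var Par) : Prop :=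
  ∀ a : Var ⊕ Par, IPC {A} (Formula.iff (.atom a) (θ.apply (.atom a)))

/-- `θ` is a `Γ`-fier for `A`: `θ(A)` is provably equivalent to an element of `Γ`. -/
def IsFier (Γ : Set (Formula (Var ⊕ Par))) (A : Formula (Var ⊕ Par)) (θ : Subst Var Par) : Prop :=
  ∃ A' ∈ Γ, Equivalent (θ.apply A) A'

/-- `θ` projects `A` to `Γ`. -/
def Projects (θ : Subst Var Par) (A : Formula (Var ⊕ Par)) (Γ : Set (Formula (Var ⊕ Par))) : Prop :=
  θ.IsProjective A ∧ θ.IsFier Γ A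

end Subst

/-- `A` is `Γ`-projective. -/
def IsProjectiveTo (Γ : Set (Formula (Var ⊕ Par))) (A : Formula (Var ⊕ Par)) : Prop :=
  ∃ θ : Subst Var Par, θ.Projects A Γ

open Classical in
/-- `θ_A^x`, for a set `x` of variables: it maps a variable `y` to `A → y` if `y ∈ x` and to
`A ∧ y` otherwise. -/
noncomputable def thetaOne (A : Formula (Var ⊕ Par)) (x : Set Var) : Subst Var Par := fun y =>
  if y ∈ x then .imp A (.atom (.inl y)) else .and A (.atom (.inl y))

/-- `θ_A^{x_s} ⋯ θ_A^{x_1}`, for a list `x_1, …, x_s` of sets of variables; the substitution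
`θ_A^{x_1}` is applied to a formula first. -/
noncomputable def theta (A : Formula (Var ⊕ Par)) : List (Set Var) → Subst Var Par
  | [] => Subst.id
  | x :: l => (theta A l).comp (thetaOne A x)

/-- `l` lists all sets of variables in such a way that `x_i ⊆ x_j` implies `i ≤ j` (in particular
without repetition). -/
def IsSubsetListing (l : List (Set Var)) : Prop :=
  (∀ x, x ∈ l) ∧ ∀ i j : Fin l.length, l.get i ⊆ l.get j → i ≤ j

open Classical in
/-- `⋁_{K ⊩ p, A} ⋀ {B ∈ NNIL(par) : K ⊩ B}`, for a set `p` of parameters. Formulas of `NNIL(par)`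
are replaced by representatives modulo provable equivalence, so that the conjunction and the
disjunction are finite: the disjunction runs over the sets of representatives of the form
`{B : K ⊩ B}`. -/
noncomputable def daggerDisj [Finite Par] (A : Formula (Var ⊕ Par)) (p : Finset Par) :
    Formula (Var ⊕ Par) :=
  let N := nnilReps (parAtoms Var Par) (Set.finite_range Sum.inr)
  Formula.bigDisj
    {Δ ∈ N.powerset | ∃ (F : Frame) (K : Model F (Var ⊕ Par)),
      (∀ q ∈ p, K.Valid (.atom (.inr q))) ∧ K.Valid A ∧ ∀ B ∈ N, (B ∈ Δ ↔ K.Valid B)}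
    fun Δ => Formula.bigConj Δ fun B => B

/-- `A† = ⋀_{p ⊆ par} (⋀ p → ⋁_{K ⊩ p, A} ⋀ {B ∈ NNIL(par) : K ⊩ B})`. -/
noncomputable def dagger [Fintype Par] (A : Formula (Var ⊕ Par)) : Formula (Var ⊕ Par) :=
  Formula.bigConj (Finset.univ : Finset (Finset Par)) fun p =>
    .imp (Formula.bigConj p fun q => .atom (.inr q)) (daggerDisj A p)

end Projectivity

end RelUnif

/-!
By soundness and completeness for finite trees, all three conditions are statements about models.
A substitution `θ` acts on models by `K ↦ K.pull θ`, where an atom is true in `K.pull θ` wherever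
its image under `θ` is forced in `K`; then `K.pull θ ⊩ B` iff `K ⊩ θ(B)`, and `θ` is `A`-projective
iff it changes nothing at the worlds that force `A`. The formula `A†` is, up to equivalence, in
`NNIL(par)` (`exists_equivalent_dagger`), so the first condition implies the second.

If `θ` projects `A` to an NNIL formula `A'` in the parameters, then `A'` is valid in every model
of `A`, hence in the submodels, since NNIL formulas are inherited along monotone maps
(`Formula.NNIL.forces_of_map`). So `K'.pull θ` is the variant of `K'` that extendibility asks for
(`extendible_of_isProjectiveTo`).

Conversely, let `A` be extendible. Every model of `A` validates `A†`, so `θ_A(A)` implies `A†`. For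
the other direction one shows, by induction down the tree, that every world `w` forcing `A†` in
`K` forces `A` in `K.pull θ_A`. Two facts combine:

* The formula `A†` yields a model `L` of `A` such that `w` forces the `NNIL(par)`-theory of `L`.
  By the NNIL preservation theorem there is a monotone map from the tree above `w` to `L` that
  preserves the parameters, and grafting copies of parts of `L` along this map gives a model of
  `A` that contains the tree above `w` as a submodel (`Model.exists_isSubmodel`). As `A` is already
  forced strictly above `w` in `K.pull θ_A`, extendibility supplies a set `z` of variables which,
  made true at `w`, would force `A` there.
* The order in which `θ_A` applies the factors `θ_A^x`, larger sets first, guarantees that when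
  `θ_A^z` is applied, the worlds strictly above `w` force `A` already. The variables in `z` are
  true at all of them, so this factor makes exactly the variables in `z` true at `w` if `w` does
  not yet force `A` (`Model.forces_theta_root`).
-/

namespace RelUnif

/-! ### Kripke semantics -/

namespace Formula

theorem inLang_univ {α : Type*} (A : Formula α) : A.InLang Set.univ := by
  induction A with
  | atom a => trivial
  | bot => trivial
  | and _ _ h₁ h₂ => exact ⟨h₁, h₂⟩
  | or _ _ h₁ h₂ => exact ⟨h₁, h₂⟩
  | imp _ _ h₁ h₂ => exact ⟨h₁, h₂⟩

end Formula

namespace Model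

variable {α : Type*} {F G : Frame}

theorem ext_V {K L : Model F α} (h : ∀ w a, K.V w a ↔ L.V w a) : K = L := by
  cases K
  cases L
  congr
  funext w a
  exact propext (h w a)

theorem Forces.mono {K : Model F α} {w u : F.W} {A : Formula α} (h : K.Forces w A)
    (hwu : w ≤ u) : K.Forces u A := by
  induction A with
  | atom a => exact K.mono hwu h
  | bot => exact h
  | and A B ihA ihB => exact ⟨ihA h.1, ihB h.2⟩
  | or A B ihA ihB => exact Or.imp ihA ihB h
  | imp A B _ _ => exact fun v huv => h v (hwu.trans huv)

theorem valid_iff_root {K : Model F α} {A : Formula α} : K.Valid A ↔ K.Forces F.root A :=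
  ⟨fun h => h _, fun h w => h.mono (F.root_le w)⟩

theorem forces_iff {K : Model F α} {w : F.W} {A B : Formula α} :
    K.Forces w (.iff A B) ↔ ∀ u, w ≤ u → (K.Forces u A ↔ K.Forces u B) :=
  ⟨fun h u hu => ⟨h.1 u hu, h.2 u hu⟩,
    fun h => ⟨fun u hu => (h u hu).1, fun u hu => (h u hu).2⟩⟩

theorem forces_top {K : Model F α} {w : F.W} : K.Forces w .top := fun _ _ h => h

theorem forces_listConj {K : Model F α} {w : F.W} {l : List (Formula α)} :
    K.Forces w (.listConj l) ↔ ∀ A ∈ l, K.Forces w A := by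
  induction l with
  | nil => simpa [Formula.listConj] using forces_top (K := K)
  | cons A l ih =>
    rw [List.forall_mem_cons, ← ih]
    rfl

theorem forces_listDisj {K : Model F α} {w : F.W} {l : List (Formula α)} :
    K.Forces w (.listDisj l) ↔ ∃ A ∈ l, K.Forces w A := by
  induction l with
  | nil => simp [Formula.listDisj, Forces]
  | cons A l ih => simp [Formula.listDisj, Forces, ih]

theorem forces_bigConj {ι : Type*} {K : Model F α} {w : F.W} {s : Finset ι}
    {B : ι → Formula α} : K.Forces w (.bigConj s B) ↔ ∀ i ∈ s, K.Forces w (B i) := by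
  simp [Formula.bigConj, forces_listConj]

theorem forces_bigDisj {ι : Type*} {K : Model F α} {w : F.W} {s : Finset ι}
    {B : ι → Formula α} : K.Forces w (.bigDisj s B) ↔ ∃ i ∈ s, K.Forces w (B i) := by
  simp [Formula.bigDisj, forces_listDisj]

/-- Bounded morphisms preserve and reflect forcing. The valuations need only agree above `w`, on
the atoms that may occur in the formula. -/
theorem forces_boundedMorphism {K : Model F α} {L : Model G α} {f : F.W → G.W} (hf : Monotone f)
    (back : ∀ u v, f u ≤ v → ∃ u', u ≤ u' ∧ f u' = v) {X : Set α} {A : Formula α}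
    (hA : A.InLang X) {w : F.W} (hV : ∀ u, w ≤ u → ∀ a ∈ X, (K.V u a ↔ L.V (f u) a)) :
    K.Forces w A ↔ L.Forces (f w) A := by
  induction A generalizing w with
  | atom a => exact hV w le_rfl a hA
  | bot => exact Iff.rfl
  | and A B ihA ihB => exact and_congr (ihA hA.1 hV) (ihB hA.2 hV)
  | or A B ihA ihB => exact or_congr (ihA hA.1 hV) (ihB hA.2 hV)
  | imp A B ihA ihB =>
    have hV' : ∀ u, w ≤ u → ∀ u', u ≤ u' → ∀ a ∈ X, (K.V u' a ↔ L.V (f u') a) :=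
      fun u hu u' hu' => hV u' (hu.trans hu')
    constructor
    · intro h v hv hvA
      obtain ⟨u, hu, rfl⟩ := back w v hv
      exact (ihB hA.2 (hV' u hu)).1 (h u hu ((ihA hA.1 (hV' u hu)).2 hvA))
    · intro h u hu huA
      exact (ihB hA.2 (hV' u hu)).2 (h (f u) (hf hu) ((ihA hA.1 (hV' u hu)).1 huA))

theorem forces_congr {K L : Model F α} {X : Set α} {A : Formula α} (hA : A.InLang X) {w : F.W}
    (hV : ∀ u, w ≤ u → ∀ a ∈ X, (K.V u a ↔ L.V u a)) : K.Forces w A ↔ L.Forces w A :=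
  forces_boundedMorphism (f := _root_.id) monotone_id (fun _ v h => ⟨v, h, rfl⟩) hA hV

end Model

/-- The subtree of worlds above `w`. -/
def Frame.above (F : Frame) (w : F.W) : Frame where
  W := Set.Ici w
  root := ⟨w, le_rfl⟩
  root_le u := u.2
  tree u v₁ v₂ := F.tree u.1 v₁.1 v₂.1

/-- The submodel generated by the world `w`. -/
def Model.above {α : Type*} {F : Frame} (K : Model F α) (w : F.W) : Model (F.above w) α where
  V u a := K.V u.1 a
  mono h := K.mono h

theorem Model.forces_above {α : Type*} {F : Frame} {K : Model F α} {w : F.W}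
    {u : (F.above w).W} {A : Formula α} : (K.above w).Forces u A ↔ K.Forces u.1 A :=
  forces_boundedMorphism (L := K) (f := fun u : (F.above w).W => u.1) (fun _ _ h => h)
    (fun u v h => ⟨⟨v, le_trans (Set.mem_Ici.1 u.2) h⟩, h, rfl⟩) A.inLang_univ fun _ _ _ _ => Iff.rfl

theorem Model.valid_above {α : Type*} {F : Frame} {K : Model F α} {w : F.W} {A : Formula α} :
    (K.above w).Valid A ↔ K.Forces w A :=
  valid_iff_root.trans forces_above

/-! ### Soundness, and completeness for finite trees -/

section Completeness

variable {α : Type*}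

theorem IPC.sound {Γ : Set (Formula α)} {A : Formula α} (h : IPC Γ A) {F : Frame}
    (K : Model F α) (w : F.W) (hΓ : ∀ B ∈ Γ, K.Forces w B) : K.Forces w A := by
  induction h generalizing w with
  | ax h => exact hΓ _ h
  | botE _ ih => exact (ih w hΓ).elim
  | andI _ _ ih₁ ih₂ => exact ⟨ih₁ w hΓ, ih₂ w hΓ⟩
  | andE₁ _ ih => exact (ih w hΓ).1
  | andE₂ _ ih => exact (ih w hΓ).2
  | orI₁ _ ih => exact .inl (ih w hΓ)
  | orI₂ _ ih => exact .inr (ih w hΓ)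
  | orE _ _ _ ih₁ ih₂ ih₃ =>
    exact (ih₁ w hΓ).elim (fun h => ih₂ w (Set.forall_mem_insert.2 ⟨h, hΓ⟩))
      fun h => ih₃ w (Set.forall_mem_insert.2 ⟨h, hΓ⟩)
  | impI _ ih =>
    exact fun u hu h => ih u (Set.forall_mem_insert.2 ⟨h, fun B hB => (hΓ B hB).mono hu⟩)
  | impE _ _ ih₁ ih₂ => exact ih₁ w hΓ w le_rfl (ih₂ w hΓ)

/-- The set of subformulas. -/
def Formula.sub : Formula α → Set (Formula α)
  | .atom a => {.atom a}
  | .bot => {.bot}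
  | .and A B => insert (.and A B) (A.sub ∪ B.sub)
  | .or A B => insert (.or A B) (A.sub ∪ B.sub)
  | .imp A B => insert (.imp A B) (A.sub ∪ B.sub)

theorem Formula.self_mem_sub (A : Formula α) : A ∈ A.sub := by
  cases A <;> simp [Formula.sub]

theorem Formula.sub_finite (A : Formula α) : A.sub.Finite := by
  induction A with
  | atom a => exact Set.finite_singleton _
  | bot => exact Set.finite_singleton _
  | and _ _ h₁ h₂ => exact (h₁.union h₂).insert _
  | or _ _ h₁ h₂ => exact (h₁.union h₂).insert _
  | imp _ _ h₁ h₂ => exact (h₁.union h₂).insert _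

theorem Formula.sub_subset_sub {A B : Formula α} (h : B ∈ A.sub) : B.sub ⊆ A.sub := by
  induction A with
  | atom a => rw [show B = .atom a from h]
  | bot => rw [show B = .bot from h]
  | and _ _ h₁ h₂ | or _ _ h₁ h₂ | imp _ _ h₁ h₂ =>
    rcases h with rfl | h | h
    · rfl
    · exact (h₁ h).trans (Set.subset_union_left.trans (Set.subset_insert _ _))
    · exact (h₂ h).trans (Set.subset_union_right.trans (Set.subset_insert _ _))

/-- The tree obtained from finitely many trees by adding a root below all of them. -/
def Frame.glue {ι : Type} [Finite ι] (G : ι → Frame) : Frame where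
  W := WithBot (Σ i, (G i).W)
  finite := inferInstanceAs (Finite (Option _))
  root := ⊥
  root_le _ := bot_le
  tree w u v hu hv := by
    induction u with
    | bot => exact .inl bot_le
    | coe u =>
      induction v with
      | bot => exact .inr bot_le
      | coe v =>
        induction w with
        | bot => simp at hu
        | coe w =>
          rw [WithBot.coe_le_coe] at hu hv ⊢
          rw [WithBot.coe_le_coe]
          obtain ⟨i, u, w, hu⟩ := hu
          obtain ⟨_, v, _, hv⟩ := hv
          exact ((G i).tree w u v hu hv).imp (.fiber i _ _) (.fiber i _ _)

/-- The model on the glued tree that extends the models `M i`, with `T` the set of atoms true at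
the new root. -/
def Model.glue {ι : Type} [Finite ι] {G : ι → Frame} (M : ∀ i, Model (G i) α) (T : Set α)
    (hT : ∀ i, ∀ a ∈ T, (M i).V (G i).root a) : Model (Frame.glue G) α where
  V w a := WithBot.recBotCoe (C := fun _ => Prop) (a ∈ T) (fun x => (M x.1).V x.2 a) w
  mono {w u a} h := by
    induction u using WithBot.recBotCoe with
    | bot =>
      obtain rfl : w = (Frame.glue G).root := le_antisymm h ((Frame.glue G).root_le w)
      exact _root_.id
    | coe u =>
      induction w using WithBot.recBotCoe with
      | bot => exact fun ha => (M u.1).mono ((G u.1).root_le u.2) (hT u.1 a ha)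
      | coe w =>
        obtain ⟨i, w, u, hwu⟩ := WithBot.coe_le_coe.1 h
        exact (M i).mono hwu

theorem Model.forces_glue {ι : Type} [Finite ι] {G : ι → Frame} {M : ∀ i, Model (G i) α}
    {T : Set α} {hT : ∀ i, ∀ a ∈ T, (M i).V (G i).root a} {i : ι} {w : (G i).W}
    {A : Formula α} :
    (Model.glue M T hT).Forces (WithBot.some ⟨i, w⟩) A ↔ (M i).Forces w A := by
  refine (forces_boundedMorphism (L := Model.glue M T hT)
    (f := fun w : (G i).W => (WithBot.some (⟨i, w⟩ : Σ i, (G i).W)))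
    (fun u v h => WithBot.coe_le_coe.2 (Sigma.mk_le_mk_iff.2 h)) (fun u v h => ?_)
    A.inLang_univ fun _ _ _ _ => Iff.rfl).symm
  induction v using WithBot.recBotCoe with
  | bot => exact absurd h (WithBot.not_coe_le_bot _)
  | coe v =>
    obtain ⟨_, u, v, huv⟩ := WithBot.coe_le_coe.1 h
    exact ⟨v, huv, rfl⟩

/-- Within a finite set `S` closed under subformulas, an underivable sequent has a countermodel.
The set of hypotheses is enlarged to a maximal `T ⊆ S` that does not derive the conclusion; the
implications of `S` that `T` does not derive are refuted in trees placed above a root at which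
precisely the formulas of `T` (among those of `S`) are forced. -/
theorem exists_countermodel_of_closed {S : Set (Formula α)} (hS : S.Finite)
    (hsub : ∀ A ∈ S, A.sub ⊆ S) (n : ℕ) (Γ : Set (Formula α)) (hΓ : Γ ⊆ S)
    (hn : (S \ Γ).ncard = n) {B : Formula α} (hB : B ∈ S) (h : ¬ IPC Γ B) :
    ∃ (F : Frame) (K : Model F α), (∀ C ∈ Γ, K.Forces F.root C) ∧ ¬ K.Forces F.root B := by
  induction n using Nat.strong_induction_on generalizing Γ B with
  | _ n ih =>
    have hfin : {T | T ⊆ S ∧ ¬ IPC T B}.Finite := hS.finite_subsets.subset fun T hT => hT.1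
    obtain ⟨T, hΓT, hT⟩ := hfin.exists_le_maximal (a := Γ) ⟨hΓ, h⟩
    obtain ⟨hTS, hTB⟩ := hT.prop
    have hmax : ∀ C ∈ S, C ∉ T → IPC (insert C T) B := by
      intro C hC hCT
      by_contra hcon
      exact hCT (hT.le_of_ge (y := insert C T) ⟨Set.insert_subset hC hTS, hcon⟩
        (Set.subset_insert _ _) (Set.mem_insert _ _))
    have hded : ∀ C ∈ S, IPC T C → C ∈ T := by
      intro C hC hTC
      by_contra hCT
      exact hTB (.impE (.impI (hmax C hC hCT)) hTC)
    -- The implications of `S` that have to be refuted above the root.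
    let I := {p : Formula α × Formula α //
      Formula.imp p.1 p.2 ∈ S ∧ ¬ IPC T (.imp p.1 p.2) ∧ p.1 ∉ T}
    have : Finite I := by
      have := hS.to_subtype
      refine Finite.of_injective (fun p : I => (⟨_, p.2.1⟩ : S)) fun p q hpq => ?_
      have hpq' := congrArg Subtype.val hpq
      injection hpq' with h₁ h₂
      exact Subtype.ext (Prod.ext h₁ h₂)
    obtain ⟨m, ⟨e⟩⟩ := Finite.exists_equiv_fin I
    have hex : ∀ i : Fin m, ∃ (F : Frame) (K : Model F α),
        (∀ C ∈ insert (e.symm i).1.1 T, K.Forces F.root C) ∧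
          ¬ K.Forces F.root (e.symm i).1.2 := by
      intro i
      obtain ⟨⟨C, D⟩, hCD, hTCD, hCT⟩ := e.symm i
      have hCS : C ∈ S := hsub _ hCD (.inr (.inl C.self_mem_sub))
      refine ih _ ?_ _ (Set.insert_subset hCS hTS) rfl
        (hsub _ hCD (.inr (.inr D.self_mem_sub))) fun hD => hTCD (.impI hD)
      rw [← hn]
      exact Set.ncard_lt_ncard ⟨Set.sdiff_subset_sdiff_right
        (hΓT.trans (Set.subset_insert _ _)), fun hss =>
          (hss ⟨hCS, fun hC => hCT (hΓT hC)⟩).2 (Set.mem_insert _ _)⟩ hS.sdiff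
    choose G M hM hM' using hex
    have hMT : ∀ i, ∀ a ∈ {a | Formula.atom a ∈ T}, (M i).V (G i).root a :=
      fun i a ha => hM i _ (Set.mem_insert_of_mem _ ha)
    let K := Model.glue M {a | Formula.atom a ∈ T} hMT
    have truth : ∀ A ∈ S, (K.Forces (Frame.glue G).root A ↔ A ∈ T) := by
      intro A hA
      induction A with
      | atom a => exact Iff.rfl
      | bot => exact ⟨False.elim, fun hbot => hTB (.botE (.ax hbot))⟩
      | and C D ihC ihD =>
        have hC := ihC (hsub _ hA (.inr (.inl C.self_mem_sub)))
        have hD := ihD (hsub _ hA (.inr (.inr D.self_mem_sub)))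
        refine (and_congr hC hD).trans ⟨fun h => hded _ hA (.andI (.ax h.1) (.ax h.2)),
          fun h => ⟨hC.1 (hC.2 (hded _ ?_ (.andE₁ (.ax h)))), hded _ ?_ (.andE₂ (.ax h))⟩⟩
        · exact hsub _ hA (.inr (.inl C.self_mem_sub))
        · exact hsub _ hA (.inr (.inr D.self_mem_sub))
      | or C D ihC ihD =>
        have hCS := hsub _ hA (.inr (.inl C.self_mem_sub))
        have hDS := hsub _ hA (.inr (.inr D.self_mem_sub))
        refine (or_congr (ihC hCS) (ihD hDS)).trans ⟨fun h => hded _ hA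
          (h.elim (fun h => .orI₁ (.ax h)) fun h => .orI₂ (.ax h)), fun h => ?_⟩
        by_contra! hcon
        exact hTB (.orE (.ax h) (hmax _ hCS hcon.1) (hmax _ hDS hcon.2))
      | imp C D ihC ihD =>
        have hCS := hsub _ hA (.inr (.inl C.self_mem_sub))
        have hDS := hsub _ hA (.inr (.inr D.self_mem_sub))
        constructor
        · intro hCD
          by_contra hcon
          by_cases hCT : C ∈ T
          · have hDT := (ihD hDS).1 (hCD _ le_rfl ((ihC hCS).2 hCT))
            exact hcon (hded _ hA (.impI (.ax (Set.mem_insert_of_mem _ hDT))))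
          · let p : I := ⟨(C, D), hA, fun h => hcon (hded _ hA h), hCT⟩
            have h₁ := hM (e p) C (by simp [p])
            have h₂ := hM' (e p)
            rw [show (e.symm (e p)).1.2 = D by simp [p]] at h₂
            exact h₂ (Model.forces_glue.1
              (hCD (WithBot.some ⟨e p, (G (e p)).root⟩) ((Frame.glue G).root_le _)
              (Model.forces_glue.2 h₁)))
        · intro hCD u _ hu
          induction u using WithBot.recBotCoe with
          | bot => exact (ihD hDS).2 (hded _ hDS (.impE (.ax hCD) (.ax ((ihC hCS).1 hu))))
          | coe u =>
            obtain ⟨i, u⟩ := u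
            exact Model.forces_glue.2 (hM i _ (Set.mem_insert_of_mem _ hCD) u
              ((G i).root_le u) (Model.forces_glue.1 hu))
    exact ⟨_, K, fun C hC => (truth C (hΓ hC)).2 (hΓT hC),
      fun hKB => hTB (.ax ((truth B hB).1 hKB))⟩

/-- Soundness and completeness of intuitionistic logic for finite trees. -/
theorem ipc_singleton_iff {A B : Formula α} :
    IPC {A} B ↔ ∀ (F : Frame) (K : Model F α), K.Valid A → K.Valid B := by
  constructor
  · intro h F K hA w
    exact h.sound K w fun C hC => by rw [Set.mem_singleton_iff.1 hC]; exact hA w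
  · intro h
    by_contra hcon
    obtain ⟨F, K, hA, hB⟩ := exists_countermodel_of_closed
      (A.sub_finite.union B.sub_finite)
      (fun C hC => hC.elim
        (fun h => (Formula.sub_subset_sub h).trans Set.subset_union_left)
        fun h => (Formula.sub_subset_sub h).trans Set.subset_union_right)
      _ {A} (Set.singleton_subset_iff.2 (.inl A.self_mem_sub)) rfl
      (.inr B.self_mem_sub) hcon
    exact hB (h F K (Model.valid_iff_root.2 (hA A rfl)) _)

theorem equivalent_iff_valid {A B : Formula α} :
    Equivalent A B ↔ ∀ (F : Frame) (K : Model F α), K.Valid A ↔ K.Valid B := by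
  rw [equivalent_iff, ipc_singleton_iff, ipc_singleton_iff]
  exact ⟨fun h F K => ⟨h.1 F K, h.2 F K⟩, fun h => ⟨fun F K => (h F K).1, fun F K => (h F K).2⟩⟩

theorem Equivalent.forces_iff {A B : Formula α} (h : Equivalent A B) {F : Frame}
    (K : Model F α) (w : F.W) : K.Forces w A ↔ K.Forces w B := by
  rw [← Model.valid_above, ← Model.valid_above]
  exact equivalent_iff_valid.1 h _ _

end Completeness

/-! ### NNIL formulas and monotone maps of trees -/

section NNIL

variable {α : Type*} {F G : Frame} {X : Set α}

theorem Formula.NI.forces_congr {K : Model F α} {L : Model G α} {w : F.W} {v : G.W}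
    {A : Formula α} (hA : A.NI) (hX : A.InLang X) (hV : ∀ a ∈ X, (K.V w a ↔ L.V v a)) :
    K.Forces w A ↔ L.Forces v A := by
  induction hA with
  | atom a => exact hV a hX
  | bot => exact Iff.rfl
  | and _ _ ih₁ ih₂ => exact and_congr (ih₁ hX.1) (ih₂ hX.2)
  | or _ _ ih₁ ih₂ => exact or_congr (ih₁ hX.1) (ih₂ hX.2)

/-- Monotone maps that preserve the valuation reflect the forcing of NNIL formulas. -/
theorem Formula.NNIL.forces_of_map {K : Model F α} {L : Model G α} {f : F.W → G.W}
    (hf : Monotone f) (hV : ∀ w, ∀ a ∈ X, (K.V w a ↔ L.V (f w) a)) {A : Formula α}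
    (hA : A.NNIL) (hX : A.InLang X) {w : F.W} (h : L.Forces (f w) A) : K.Forces w A := by
  induction hA generalizing w with
  | atom a => exact (hV w a hX).2 h
  | bot => exact h
  | and _ _ ih₁ ih₂ => exact ⟨ih₁ hX.1 h.1, ih₂ hX.2 h.2⟩
  | or _ _ ih₁ ih₂ => exact Or.imp (ih₁ hX.1) (ih₂ hX.2) h
  | imp hA _ ih =>
    exact fun u hu hu' => ih hX.2 (h (f u) (hf hu) ((hA.forces_congr hX.1 (hV u)).1 hu'))

/-- `a₁ → (a₂ → ⋯ → (aₙ → C))`, for a list of atoms. Unlike `⋀ aᵢ → C`, whose antecedent ends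
in `⊤`, it is literally an NNIL formula when `C` is. -/
def Formula.impList (l : List α) (C : Formula α) : Formula α :=
  l.foldr (fun a D => .imp (.atom a) D) C

theorem Formula.impList_mem {l : List α} {C : Formula α} (hl : ∀ a ∈ l, a ∈ X)
    (hC : C ∈ NNILOver X) : impList l C ∈ NNILOver X := by
  induction l with
  | nil => exact hC
  | cons a l ih =>
    rw [List.forall_mem_cons] at hl
    exact ⟨.imp (.atom a) (ih hl.2).1, hl.1, (ih hl.2).2⟩

theorem Model.forces_impList {K : Model F α} {w : F.W} {l : List α} {C : Formula α} :
    K.Forces w (.impList l C) ↔ ∀ u, w ≤ u → (∀ a ∈ l, K.V u a) → K.Forces u C := by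
  induction l generalizing w with
  | nil => exact ⟨fun h u hu _ => h.mono hu, fun h => h w le_rfl (by simp)⟩
  | cons a l ih =>
    refine ⟨fun h u hu hl => ?_, fun h u hu ha => ih.2 fun v hv hl => ?_⟩
    · rw [List.forall_mem_cons] at hl
      exact ih.1 (h u hu hl.1) u le_rfl hl.2
    · exact h v (hu.trans hv) (List.forall_mem_cons.2 ⟨K.mono hv ha, hl⟩)

theorem Formula.listDisj_mem {l : List (Formula α)} (h : ∀ A ∈ l, A ∈ NNILOver X) :
    listDisj l ∈ NNILOver X := by
  induction l with
  | nil => exact ⟨.bot, trivial⟩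
  | cons A l ih =>
    rw [List.forall_mem_cons] at h
    exact ⟨.or h.1.1 (ih h.2).1, h.1.2, (ih h.2).2⟩

theorem Formula.listConj_mem {l : List (Formula α)} (h : ∀ A ∈ l, A ∈ NNILOver X) :
    listConj l ∈ NNILOver X := by
  induction l with
  | nil => exact ⟨.imp .bot .bot, trivial, trivial⟩
  | cons A l ih =>
    rw [List.forall_mem_cons] at h
    exact ⟨.and h.1.1 (ih h.2).1, h.1.2, (ih h.2).2⟩

theorem Formula.bigDisj_mem {ι : Type*} {s : Finset ι} {B : ι → Formula α}
    (h : ∀ i ∈ s, B i ∈ NNILOver X) : bigDisj s B ∈ NNILOver X :=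
  listDisj_mem (by simpa using h)

theorem Formula.bigConj_mem {ι : Type*} {s : Finset ι} {B : ι → Formula α}
    (h : ∀ i ∈ s, B i ∈ NNILOver X) : bigConj s B ∈ NNILOver X :=
  listConj_mem (by simpa using h)

/-- The formulas of `NNIL(X)` forced at `w`. -/
def Model.nnilTheory (X : Set α) (K : Model F α) (w : F.W) : Set (Formula α) :=
  {B | B ∈ Formula.NNILOver X ∧ K.Forces w B}

/-- If `w` forces all formulas of `NNIL(X)` that `v` forces, then so does `w` for some `v' ≥ v`
at which the same atoms of `X` are true as at `w`. Otherwise every such `v'` forces some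
`B v'` in `NNIL(X)` that `w` does not force, and `v` forces that, if all atoms true at `w` hold,
then some atom false at `w` or some `B v'` does, which fails at `w`. -/
theorem Model.exists_nnilTheory_subset (hX : X.Finite) {K : Model F α} {L : Model G α} {w : F.W}
    {v : G.W} (h : L.nnilTheory X v ⊆ K.nnilTheory X w) :
    ∃ v', v ≤ v' ∧ (∀ a ∈ X, (K.V w a ↔ L.V v' a)) ∧ L.nnilTheory X v' ⊆ K.nnilTheory X w := by
  classical
  by_contra! hcon
  have hex : ∀ v' : G.W, ∃ B ∈ Formula.NNILOver X, ¬ K.Forces w B ∧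
      (v ≤ v' → (∀ a ∈ X, (K.V w a ↔ L.V v' a)) → L.Forces v' B) := by
    intro v'
    by_cases hv : v ≤ v' ∧ ∀ a ∈ X, (K.V w a ↔ L.V v' a)
    · obtain ⟨B, hB, hB'⟩ := Set.not_subset.1 (hcon v' hv.1 hv.2)
      exact ⟨B, hB.1, fun hw => hB' ⟨hB.1, hw⟩, fun _ _ => hB.2⟩
    · exact ⟨.bot, ⟨.bot, trivial⟩, fun h => h, fun h₁ h₂ => (hv ⟨h₁, h₂⟩).elim⟩
  choose B hBX hBw hBv using hex
  have : Fintype G.W := Fintype.ofFinite _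
  let P := hX.toFinset.filter fun a => K.V w a
  let Q := hX.toFinset.filter fun a => ¬ K.V w a
  let C : Formula α := .impList P.toList
    (.or (.bigDisj Q .atom) (.bigDisj (Finset.univ : Finset G.W) B))
  have hQ : Formula.bigDisj Q .atom ∈ Formula.NNILOver X :=
    Formula.bigDisj_mem fun a ha => 
      ⟨.atom a, hX.mem_toFinset.1 (Finset.mem_filter.1 ha).1⟩
  have hB : Formula.bigDisj (Finset.univ : Finset G.W) B ∈ Formula.NNILOver X :=
    Formula.bigDisj_mem fun v' _ => hBX v'
  have hC : C ∈ Formula.NNILOver X :=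
    Formula.impList_mem (fun a ha => by simp [P] at ha; exact ha.1)
      ⟨.or hQ.1 hB.1, hQ.2, hB.2⟩
  have hv : L.Forces v C := by
    refine forces_impList.2 fun v' hv' hP => ?_
    by_cases hq : ∃ a ∈ Q, L.V v' a
    · exact .inl (forces_bigDisj.2 hq)
    · refine .inr (forces_bigDisj.2 ⟨v', Finset.mem_univ _, hBv v' hv' fun a ha => ?_⟩)
      push Not at hq
      refine ⟨fun hw => hP a (by simp [P, ha, hw]), fun hv'a => ?_⟩
      by_contra hw
      exact hq a (by simp [Q, ha, hw]) hv'a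
  rcases forces_impList.1 (h ⟨hC, hv⟩).2 w le_rfl (fun a ha => by simp [P] at ha; exact ha.2)
    with hw | hw
  · obtain ⟨a, ha, hw⟩ := forces_bigDisj.1 hw
    exact (Finset.mem_filter.1 ha).2 hw
  · obtain ⟨v', _, hw⟩ := forces_bigDisj.1 hw
    exact hBw v' hw

theorem Frame.exists_parent (F : Frame) {w : F.W} (hw : w ≠ F.root) :
    ∃ p < w, ∀ u < w, u ≤ p := by
  obtain ⟨p, -, hp⟩ := (Set.toFinite {u | u < w}).exists_le_maximal (a := F.root)
    (lt_of_le_of_ne (F.root_le w) hw.symm)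
  exact ⟨p, hp.prop, fun u hu => (F.tree w u p hu.le hp.prop.le).elim _root_.id
    fun h => hp.le_of_ge hu h⟩

/-- On a tree, a relation `Z` with the forth property contains a monotone map: its values are
chosen recursively, the value at a world being chosen above the value at its parent. -/
theorem Frame.exists_monotone {Z : F.W → G.W → Prop} (h₀ : ∃ v, Z F.root v)
    (forth : ∀ w w' v, w ≤ w' → Z w v → ∃ v', v ≤ v' ∧ Z w' v') :
    ∃ f : F.W → G.W, Monotone f ∧ ∀ w, Z w (f w) := by
  classical
  choose p hp hp' using fun w : {w : F.W // w ≠ F.root} => F.exists_parent w.2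
  choose g hg hg' using forth
  have wf : WellFounded ((· < ·) : F.W → F.W → Prop) := wellFounded_lt
  let f : ∀ w, {v // Z w v} := wf.fix fun w rec =>
    if hw : w = F.root then ⟨h₀.choose, hw ▸ h₀.choose_spec⟩
    else ⟨g _ w _ (hp ⟨w, hw⟩).le (rec _ (hp ⟨w, hw⟩)).2, hg' _ _ _ _ _⟩
  have hf : ∀ w (hw : w ≠ F.root), (f (p ⟨w, hw⟩)).1 ≤ (f w).1 := by
    intro w hw
    have e : f w = _ := wf.fix_eq _ w
    rw [e, dif_neg hw]
    exact hg _ _ _ _ _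
  refine ⟨fun w => (f w).1, fun u w => ?_, fun w => (f w).2⟩
  induction w using wf.induction with
  | _ w ih =>
    intro huw
    rcases huw.eq_or_lt with rfl | huw
    · exact le_rfl
    · have hw : w ≠ F.root := fun h => (huw.trans_le (h ▸ F.root_le u)).false
      exact (ih _ (hp ⟨w, hw⟩) (hp' ⟨w, hw⟩ u huw)).trans (hf w hw)

/-- The tree obtained from `F` by placing above each world `w` a copy of the part of `G` above
`f w`. The pair `(w, ⊥)` is the world `w` of `F`, and `(w, v)` is the world `v` of the copy
placed above `w`. -/
def Frame.graft (F G : Frame) (f : F.W → G.W) : Frame where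
  W := {x : F.W × WithBot G.W // ∀ v : G.W, x.2 = v → f x.1 ≤ v}
  order :=
    { le x y := x.1.1 ≤ y.1.1 ∧ x.1.2 ≤ y.1.2 ∧ (x.1.2 = ⊥ ∨ x.1.1 = y.1.1)
      lt x y := (x.1.1 ≤ y.1.1 ∧ x.1.2 ≤ y.1.2 ∧ (x.1.2 = ⊥ ∨ x.1.1 = y.1.1)) ∧
        ¬ (y.1.1 ≤ x.1.1 ∧ y.1.2 ≤ x.1.2 ∧ (y.1.2 = ⊥ ∨ y.1.1 = x.1.1))
      le_refl _ := ⟨le_rfl, le_rfl, .inr rfl⟩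
      le_trans x y z hxy hyz := by
        refine ⟨hxy.1.trans hyz.1, hxy.2.1.trans hyz.2.1, ?_⟩
        rcases hxy.2.2 with h | h
        · exact .inl h
        · exact hyz.2.2.imp (fun h' => le_bot_iff.1 (hxy.2.1.trans h'.le)) h.trans
      le_antisymm x y hxy hyx :=
        Subtype.ext (Prod.ext (hxy.1.antisymm hyx.1) (hxy.2.1.antisymm hyx.2.1)) }
  finite := by
    have : Finite (WithBot G.W) := inferInstanceAs (Finite (Option _))
    infer_instance
  root := ⟨(F.root, ⊥), fun v h => by simp at h⟩
  root_le _ := ⟨F.root_le _, bot_le, .inl rfl⟩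
  tree := by
    rintro ⟨⟨w, z⟩, hz⟩ ⟨⟨u₁, x⟩, hx⟩ ⟨⟨u₂, y⟩, hy⟩ ⟨h₁, h₂, h₃⟩ ⟨h₁', h₂', h₃'⟩
    dsimp only at *
    rcases h₃ with rfl | rfl
    · rcases h₃' with rfl | rfl
      · exact (F.tree w u₁ u₂ h₁ h₁').imp (⟨·, le_rfl, .inl rfl⟩) (⟨·, le_rfl, .inl rfl⟩)
      · exact .inl ⟨h₁, bot_le, .inl rfl⟩
    · rcases h₃' with rfl | rfl
      · exact .inr ⟨h₁', bot_le, .inl rfl⟩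
      · suffices h : x ≤ y ∨ y ≤ x from
          h.imp (⟨le_rfl, ·, .inr rfl⟩) (⟨le_rfl, ·, .inr rfl⟩)
        induction x with
        | bot => exact .inl bot_le
        | coe x =>
          induction y with
          | bot => exact .inr bot_le
          | coe y =>
            induction z with
            | bot => simp at h₂
            | coe z =>
              simp only [WithBot.coe_le_coe] at *
              exact G.tree z x y h₂ h₂'

/-- The projection of the grafted tree to `G`. -/
def Frame.graftProj {f : F.W → G.W} (x : (F.graft G f).W) : G.W :=
  WithBot.unbotD (f x.1.1) x.1.2

theorem Frame.monotone_graftProj {f : F.W → G.W} (hf : Monotone f) :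
    Monotone (Frame.graftProj (f := f)) := by
  rintro ⟨⟨w, x⟩, hx⟩ ⟨⟨u, y⟩, hy⟩ ⟨h₁, h₂, h₃⟩
  dsimp only [Frame.graftProj] at *
  induction x with
  | bot =>
    induction y with
    | bot => exact hf h₁
    | coe y => exact (hf h₁).trans (hy y rfl)
  | coe x =>
    induction y with
    | bot => simp at h₂
    | coe y => exact WithBot.coe_le_coe.1 h₂

theorem Frame.graftProj_back {f : F.W → G.W} (x : (F.graft G f).W) (v : G.W)
    (h : Frame.graftProj x ≤ v) : ∃ y, x ≤ y ∧ Frame.graftProj y = v := by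
  obtain ⟨⟨w, x⟩, hx⟩ := x
  have hv : f w ≤ v ∧ x ≤ v := by
    induction x with
    | bot => exact ⟨h, bot_le⟩
    | coe x => exact ⟨(hx x rfl).trans h, WithBot.coe_le_coe.2 h⟩
  exact ⟨⟨(w, v), fun v' h' => WithBot.coe_inj.1 h' ▸ hv.1⟩, ⟨le_rfl, hv.2, .inr rfl⟩, rfl⟩

/-- The model on the grafted tree for which the projection to `G` is a bounded morphism. -/
def Model.graft (L : Model G α) {f : F.W → G.W} (hf : Monotone f) : Model (F.graft G f) α where
  V x a := L.V (Frame.graftProj x) a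
  mono h := L.mono (Frame.monotone_graftProj hf h)

/-- A tree model that forces all formulas of `NNIL(X)` valid in `L` is, as far as `X` is
concerned, a submodel of a model that validates the same formulas as `L`. -/
theorem Model.exists_isSubmodel (hX : X.Finite) {K : Model F α} {L : Model G α}
    (h : ∀ B ∈ Formula.NNILOver X, L.Valid B → K.Valid B) {A : Formula α} (hA : L.Valid A) :
    ∃ (H : Frame) (M : Model H α), M.Valid A ∧ K.IsSubmodel X M := by
  let Z : F.W → G.W → Prop := fun w v =>
    (∀ a ∈ X, (K.V w a ↔ L.V v a)) ∧ L.nnilTheory X v ⊆ K.nnilTheory X w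
  have h₀ : ∃ v, Z F.root v := by
    obtain ⟨v, -, hv⟩ := exists_nnilTheory_subset hX (K := K) (w := F.root) (L := L)
      (v := G.root) fun B hB => ⟨hB.1, h B hB.1 (valid_iff_root.2 hB.2) _⟩
    exact ⟨v, hv⟩
  obtain ⟨f, hf, hZ⟩ := Frame.exists_monotone h₀ fun w w' v hww' hv =>
    exists_nnilTheory_subset hX fun B hB => ⟨hB.1, (hv.2 hB).2.mono hww'⟩
  refine ⟨F.graft G f, L.graft hf, fun x => ?_, ?_⟩
  · exact (forces_boundedMorphism (Frame.monotone_graftProj hf) Frame.graftProj_back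
      A.inLang_univ fun _ _ _ _ => Iff.rfl).2 (hA (Frame.graftProj x))
  · exact ⟨⟨⟨fun w => ⟨(w, ⊥), fun v h => by simp at h⟩, fun w u e =>
      congrArg (fun x : (F.graft G f).W => x.1.1) e⟩,
      ⟨fun h => h.1, fun h => ⟨h, le_rfl, .inl rfl⟩⟩⟩, fun w => (hZ w).1⟩

end NNIL

/-! ### Substitutions acting on models -/

section Substitution

variable {Var Par : Type*} {F : Frame}

/-- The model in which an atom `a` is true where `θ(a)` is forced in `K`. -/
def Model.pull (K : Model F (Var ⊕ Par)) (θ : Subst Var Par) : Model F (Var ⊕ Par) where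
  V w a := K.Forces w (θ.apply (.atom a))
  mono h ha := Forces.mono ha h

theorem Model.forces_pull {K : Model F (Var ⊕ Par)} {θ : Subst Var Par} {w : F.W}
    {A : Formula (Var ⊕ Par)} : (K.pull θ).Forces w A ↔ K.Forces w (θ.apply A) := by
  induction A generalizing w with
  | atom a => exact Iff.rfl
  | bot => exact Iff.rfl
  | and A B ihA ihB => exact and_congr ihA ihB
  | or A B ihA ihB => exact or_congr ihA ihB
  | imp A B ihA ihB => exact forall₂_congr fun u _ => imp_congr ihA ihB

theorem Model.pull_id (K : Model F (Var ⊕ Par)) : K.pull Subst.id = K :=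
  ext_V fun _ a => by cases a <;> exact Iff.rfl

theorem Model.pull_comp (K : Model F (Var ⊕ Par)) (θ τ : Subst Var Par) :
    K.pull (θ.comp τ) = (K.pull θ).pull τ :=
  ext_V fun _ a => by
    cases a with
    | inl y => exact (forces_pull (K := K) (A := τ y)).symm
    | inr q => exact Iff.rfl

theorem Model.above_pull (K : Model F (Var ⊕ Par)) (θ : Subst Var Par) (w : F.W) :
    (K.pull θ).above w = (K.above w).pull θ :=
  ext_V fun _ _ => forces_above.symm

theorem Subst.isProjective_iff {A : Formula (Var ⊕ Par)} {θ : Subst Var Par} :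
    θ.IsProjective A ↔ ∀ (F : Frame) (K : Model F (Var ⊕ Par)) (w : F.W), K.Forces w A →
      ∀ a, ((K.pull θ).V w a ↔ K.V w a) := by
  refine ⟨fun h F K w hw a => ?_, fun h a => ipc_singleton_iff.2 fun F K hK w =>
    Model.forces_iff.2 fun u _ => (h F K u (hK u) a).symm⟩
  exact (Model.forces_iff.1 ((h a).sound K w fun B hB => by
    rwa [Set.mem_singleton_iff.1 hB]) w le_rfl).symm

theorem Model.forces_pull_of_forces {K : Model F (Var ⊕ Par)} {θ : Subst Var Par}
    {A : Formula (Var ⊕ Par)} (hθ : θ.IsProjective A) {w : F.W} (h : K.Forces w A) :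
    (K.pull θ).Forces w A :=
  (forces_congr A.inLang_univ fun u hu a _ =>
    Subst.isProjective_iff.1 hθ F K u (h.mono hu) a).2 h

theorem Subst.isProjective_id (A : Formula (Var ⊕ Par)) :
    (Subst.id : Subst Var Par).IsProjective A :=
  isProjective_iff.2 fun F K w _ a => by rw [Model.pull_id]

theorem Subst.IsProjective.comp {A : Formula (Var ⊕ Par)} {θ τ : Subst Var Par}
    (hθ : θ.IsProjective A) (hτ : τ.IsProjective A) : (θ.comp τ).IsProjective A :=
  isProjective_iff.2 fun F K w hw a => by
    rw [Model.pull_comp]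
    exact (isProjective_iff.1 hτ F _ w (Model.forces_pull_of_forces hθ hw) a).trans
      (isProjective_iff.1 hθ F K w hw a)

theorem Model.pull_thetaOne_V_of_mem {K : Model F (Var ⊕ Par)} {A : Formula (Var ⊕ Par)}
    {x : Set Var} {y : Var} (hy : y ∈ x) {w : F.W} : (K.pull (thetaOne A x)).V w (.inl y) ↔
      ∀ u, w ≤ u → K.Forces u A → K.V u (.inl y) := by
  simp only [pull, Subst.apply, thetaOne, if_pos hy]
  exact Iff.rfl

theorem Model.pull_thetaOne_V_of_notMem {K : Model F (Var ⊕ Par)} {A : Formula (Var ⊕ Par)}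
    {x : Set Var} {y : Var} (hy : y ∉ x) {w : F.W} : (K.pull (thetaOne A x)).V w (.inl y) ↔
      K.Forces w A ∧ K.V w (.inl y) := by
  simp only [pull, Subst.apply, thetaOne, if_neg hy]
  exact Iff.rfl

theorem isProjective_thetaOne (A : Formula (Var ⊕ Par)) (x : Set Var) :
    (thetaOne A x).IsProjective A := by
  refine Subst.isProjective_iff.2 fun F K w hw a => ?_
  rcases a with y | q
  · by_cases hy : y ∈ x
    · rw [Model.pull_thetaOne_V_of_mem hy]
      exact ⟨fun h => h w le_rfl hw, fun h u hu _ => K.mono hu h⟩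
    · rw [Model.pull_thetaOne_V_of_notMem hy]
      exact and_iff_right hw
  · exact Iff.rfl

theorem isProjective_theta (A : Formula (Var ⊕ Par)) (l : List (Set Var)) :
    (theta A l).IsProjective A := by
  induction l with
  | nil => exact Subst.isProjective_id A
  | cons x l ih => exact ih.comp (isProjective_thetaOne A x)

/-! ### The substitution `θ_A` on models of an extendible formula -/

theorem Model.pull_theta_append (A : Formula (Var ⊕ Par)) (l₁ l₂ : List (Set Var))
    (K : Model F (Var ⊕ Par)) :
    K.pull (theta A (l₁ ++ l₂)) = (K.pull (theta A l₂)).pull (theta A l₁) := by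
  induction l₁ with
  | nil => exact (Model.pull_id _).symm
  | cons x l ih =>
    change K.pull ((theta A (l ++ l₂)).comp _) = Model.pull _ ((theta A l).comp _)
    rw [Model.pull_comp, Model.pull_comp, ih]

/-- If the factors in `l` turn `w` into a world that forces `A`, then the first factor `θ_A^x` with
that effect leaves only variables in `x` true at `w`, and later factors change nothing there. -/
theorem Model.exists_subset_of_forces_theta {A : Formula (Var ⊕ Par)} {K : Model F (Var ⊕ Par)}
    {w : F.W} (l : List (Set Var)) (h₀ : ¬ K.Forces w A) (h : (K.pull (theta A l)).Forces w A) :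
    ∃ x ∈ l, ∀ y, (K.pull (theta A l)).V w (.inl y) → y ∈ x := by
  induction l with
  | nil => exact (h₀ (K.pull_id ▸ h)).elim
  | cons x l ih =>
    have e : K.pull (theta A (x :: l)) = (K.pull (theta A l)).pull (thetaOne A x) :=
      pull_comp _ _ _
    by_cases hl : (K.pull (theta A l)).Forces w A
    · obtain ⟨x', hx', h'⟩ := ih hl
      refine ⟨x', List.mem_cons_of_mem _ hx', fun y hy => h' y ?_⟩
      rw [e] at hy
      exact (Subst.isProjective_iff.1 (isProjective_thetaOne A x) F _ w hl _).1 hy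
    · refine ⟨x, List.mem_cons_self, fun y hy => ?_⟩
      by_contra hyx
      rw [e, pull_thetaOne_V_of_notMem hyx] at hy
      exact hl hy.1

theorem IsSubsetListing.not_subset {l₁ l₂ : List (Set Var)} {z : Set Var}
    (hl : IsSubsetListing (l₁ ++ z :: l₂)) {x : Set Var} (hx : x ∈ l₁) : ¬ z ⊆ x := by
  obtain ⟨i, hi, rfl⟩ := List.getElem_of_mem hx
  intro hz
  have := hl.2 ⟨l₁.length, by simp⟩ ⟨i, by simp; omega⟩ (by
    simpa [List.getElem_append_left hi] using hz)
  exact absurd (Fin.mk_le_mk.1 this) (by omega)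

/-- The step from the worlds above the root to the root. Let `z` be the set of variables true at
the root of a variant that validates `A`. When the factor `θ_A^z` is applied, `A` is already forced
at every other world `w`: it becomes forced at `w` by some factor `θ_A^x`, and then the variables
true at `w`, among them those in `z`, belong to `x`, so that `θ_A^x` is not applied later than
`θ_A^z`. Hence `θ_A^z` turns the model into the variant, unless `A` is forced already. -/
theorem Model.forces_theta_root {A : Formula (Var ⊕ Par)} {l : List (Set Var)}
    (hl : IsSubsetListing l) {K : Model F (Var ⊕ Par)}
    (habove : (K.pull (theta A l)).ValidAboveRoot A)
    (hvar : ∃ K' : Model F (Var ⊕ Par),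
      K'.IsVariant (parAtoms Var Par) (K.pull (theta A l)) ∧ K'.Valid A) :
    (K.pull (theta A l)).Forces F.root A := by
  obtain ⟨K', hK', hA⟩ := hvar
  let z : Set Var := {y | K'.V F.root (.inl y)}
  obtain ⟨l₁, l₂, rfl⟩ := List.append_of_mem (hl.1 z)
  let K₁ := K.pull (theta A l₂)
  let K₂ := K₁.pull (thetaOne A z)
  have e₂ : K.pull (theta A (z :: l₂)) = K₂ := pull_comp _ _ _
  have e : K.pull (theta A (l₁ ++ z :: l₂)) = K₂.pull (theta A l₁) := by
    rw [pull_theta_append, e₂]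
  rw [e] at hK' habove ⊢
  refine forces_pull_of_forces (isProjective_theta A l₁) ?_
  by_cases h₁ : K₁.Forces F.root A
  · exact forces_pull_of_forces (isProjective_thetaOne A z) h₁
  have hz : ∀ y ∈ z, ∀ w, w ≠ F.root → (K₂.pull (theta A l₁)).V w (.inl y) := fun y hy w hw =>
    (hK' w _ (.inl hw)).1 (K'.mono (F.root_le w) hy)
  have h₂ : ∀ w, w ≠ F.root → K₂.Forces w A := by
    intro w hw
    by_contra hcon
    obtain ⟨x, hx, hxw⟩ := exists_subset_of_forces_theta l₁ hcon (habove w hw)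
    exact hl.not_subset hx fun y hy => hxw y (hz y hy w hw)
  have hθ : ∀ w, w ≠ F.root → ∀ a, ((K₂.pull (theta A l₁)).V w a ↔ K₂.V w a) := fun w hw =>
    Subst.isProjective_iff.1 (isProjective_theta A l₁) F K₂ w (h₂ w hw)
  suffices h : K₂ = K' from h ▸ hA _
  refine ext_V fun w a => ?_
  by_cases hw : w = F.root
  · subst hw
    rcases a with y | q
    · by_cases hy : y ∈ z
      · refine iff_of_true ((pull_thetaOne_V_of_mem hy).2 fun u _ huA => ?_) hy
        have hu : u ≠ F.root := fun hu => h₁ (hu ▸ huA)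
        exact (Subst.isProjective_iff.1 (isProjective_thetaOne A z) F K₁ u huA _).1
          ((hθ u hu _).1 (hz y hy u hu))
      · exact iff_of_false (fun h => h₁ ((pull_thetaOne_V_of_notMem hy).1 h).1) hy
    · exact (hK' _ (.inr q) (.inr ⟨q, rfl⟩)).symm
  · exact (hθ w hw a).symm.trans (hK' w a (.inl hw)).symm

/-! ### The formula `A†` -/

theorem nnilReps_subset {α : Type*} {X : Set α} (hX : X.Finite) {B : Formula α}
    (hB : B ∈ nnilReps X hX) : B ∈ Formula.NNILOver X :=
  (exists_nnilReps hX).choose_spec.1 B hB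

theorem exists_nnilReps_equivalent {α : Type*} {X : Set α} (hX : X.Finite) {B : Formula α}
    (hB : B ∈ Formula.NNILOver X) : ∃ C ∈ nnilReps X hX, Equivalent B C :=
  (exists_nnilReps hX).choose_spec.2 B hB

theorem forces_dagger [Fintype Par] {A : Formula (Var ⊕ Par)} {K : Model F (Var ⊕ Par)}
    (hK : K.Valid A) : K.Valid (dagger A) := by
  classical
  intro w
  refine Model.forces_bigConj.2 fun p _ u _ hp => ?_
  rw [Model.forces_bigConj] at hp
  let N := nnilReps (parAtoms Var Par) (Set.finite_range Sum.inr)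
  refine Model.forces_bigDisj.2 ⟨N.filter fun B => K.Forces u B, ?_,
    Model.forces_bigConj.2 fun B hB => (Finset.mem_filter.1 hB).2⟩
  refine Finset.mem_filter.2 ⟨Finset.mem_powerset.2 (Finset.filter_subset _ _),
    F.above u, K.above u, fun q hq => Model.valid_above.2 (hp q hq),
    Model.valid_above.2 (hK u), fun B hB => ?_⟩
  rw [Model.valid_above]
  exact Finset.mem_filter.trans (and_iff_right hB)

/-- A world that forces `A†` forces the `NNIL(par)`-theory of some model of `A`. -/
theorem exists_model_of_forces_dagger [Fintype Par] {A : Formula (Var ⊕ Par)}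
    {K : Model F (Var ⊕ Par)} {w : F.W} (h : K.Forces w (dagger A)) :
    ∃ (G : Frame) (L : Model G (Var ⊕ Par)), L.Valid A ∧
      ∀ B ∈ Formula.NNILOver (parAtoms Var Par), L.Valid B → K.Forces w B := by
  classical
  have hp := Model.forces_bigConj.1 h (Finset.univ.filter fun q => K.V w (.inr q))
    (Finset.mem_univ _) w le_rfl
    (Model.forces_bigConj.2 fun q hq => (Finset.mem_filter.1 hq).2)
  obtain ⟨Δ, hΔ, hw⟩ := Model.forces_bigDisj.1 hp
  obtain ⟨-, G, L, -, hA, hL⟩ := Finset.mem_filter.1 hΔ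
  refine ⟨G, L, hA, fun B hB hLB => ?_⟩
  obtain ⟨C, hC, hBC⟩ := exists_nnilReps_equivalent (Set.finite_range Sum.inr) hB
  exact (hBC.forces_iff K w).2
    (Model.forces_bigConj.1 hw C ((hL C hC).2 fun v => (hBC.forces_iff L v).1 (hLB v)))

/-- The antecedents `⋀ p` of `A†` contain `⊤`, so `A†` is an NNIL formula only up to
equivalence. -/
theorem exists_equivalent_dagger [Fintype Par] (A : Formula (Var ⊕ Par)) :
    ∃ A' ∈ Formula.NNILOver (parAtoms Var Par), Equivalent (dagger A) A' := by
  classical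
  refine ⟨.bigConj (Finset.univ : Finset (Finset Par)) fun p =>
    .impList (p.toList.map Sum.inr) (daggerDisj A p), ?_, ?_⟩
  · refine Formula.bigConj_mem fun p _ => Formula.impList_mem ?_ ?_
    · simp [parAtoms]
    · refine Formula.bigDisj_mem fun Δ hΔ => Formula.bigConj_mem fun B hB => ?_
      exact nnilReps_subset _ (Finset.mem_powerset.1 (Finset.mem_filter.1 hΔ).1 hB)
  · refine equivalent_iff_valid.2 fun F K => forall_congr' fun w => ?_
    refine Model.forces_bigConj.trans (Iff.trans ?_ Model.forces_bigConj.symm)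
    refine forall₂_congr fun p _ => Iff.trans ?_ Model.forces_impList.symm
    refine forall₂_congr fun u _ => imp_congr (Model.forces_bigConj.trans ?_) Iff.rfl
    simp [Model.Forces]

/-! ### The three implications -/

theorem extendible_of_isProjectiveTo {A : Formula (Var ⊕ Par)}
    (h : IsProjectiveTo (Formula.NNILOver (parAtoms Var Par)) A) :
    Extendible (parAtoms Var Par) A := by
  obtain ⟨θ, hθ, A', ⟨hnnil, hpar⟩, hA'⟩ := h
  rintro F K hK F' K' ⟨f, hf⟩ habove
  refine ⟨K'.pull θ, ?_, fun w => ?_⟩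
  · rintro w a (hw | ⟨q, rfl⟩)
    · exact Subst.isProjective_iff.1 hθ F' K' w (habove w hw) a
    · exact Iff.rfl
  · refine Model.forces_pull.2 ((hA'.forces_iff K' w).2 ?_)
    refine hnnil.forces_of_map f.monotone hf hpar ((hA'.forces_iff K _).1 ?_)
    exact Model.forces_pull.1 (Model.forces_pull_of_forces hθ (hK _))

theorem Model.forces_theta_of_forces_dagger [Fintype Par] {A : Formula (Var ⊕ Par)}
    {l : List (Set Var)} (hl : IsSubsetListing l) (hA : Extendible (parAtoms Var Par) A)
    {K : Model F (Var ⊕ Par)} (w : F.W) (hK : K.Forces w (dagger A)) :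
    (K.pull (theta A l)).Forces w A := by
  induction w using (wellFounded_gt (α := F.W)).induction with
  | _ w ih =>
    obtain ⟨G, L, hL, hLK⟩ := exists_model_of_forces_dagger hK
    obtain ⟨H, M, hM, hsub⟩ := Model.exists_isSubmodel (K := K.above w)
      (X := parAtoms Var Par) (Set.finite_range _)
      (fun B hB hLB => Model.valid_above.2 (hLK B hB hLB)) hL
    have habove : ((K.above w).pull (theta A l)).ValidAboveRoot A := by
      intro u hu
      rw [← above_pull, forces_above]
      have hwu : w < u.1 := lt_of_le_of_ne u.2 fun h => hu (Subtype.ext h.symm)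
      exact ih u.1 hwu (hK.mono hwu.le)
    have hsub' : ((K.above w).pull (theta A l)).IsSubmodel (parAtoms Var Par) M := by
      obtain ⟨f, hf⟩ := hsub
      refine ⟨f, ?_⟩
      rintro u _ ⟨q, rfl⟩
      exact hf u _ ⟨q, rfl⟩
    have := forces_theta_root hl habove (hA H M hM _ _ hsub' habove)
    rwa [← above_pull, forces_above] at this

theorem theta_projects_dagger [Fintype Par] {A : Formula (Var ⊕ Par)} {l : List (Set Var)}
    (hl : IsSubsetListing l) (hA : Extendible (parAtoms Var Par) A) :
    (theta A l).Projects A {dagger A} := by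
  refine ⟨isProjective_theta A l, dagger A, rfl,
    equivalent_iff_valid.2 fun F K => ⟨fun h => ?_, fun h w => ?_⟩⟩
  · obtain ⟨A', ⟨-, hpar⟩, hA'⟩ := exists_equivalent_dagger A
    intro w
    have hw := forces_dagger (K := K.pull (theta A l)) (fun u => Model.forces_pull.2 (h u)) w
    refine (hA'.forces_iff K w).2 ((Model.forces_congr hpar ?_).1 ((hA'.forces_iff _ w).1 hw))
    rintro u _ _ ⟨q, rfl⟩
    exact Iff.rfl
  · exact Model.forces_pull.1 (Model.forces_theta_of_forces_dagger hl hA w (h w))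

end Substitution

end RelUnif

theorem mainTheorem2 {Var Par : Type*} [Finite Var] [Fintype Par]
    (l : List (Set Var)) (hl : RelUnif.IsSubsetListing l)
    (A : RelUnif.Formula (Var ⊕ Par)) :
    List.TFAE [
      (RelUnif.theta A l).Projects A {RelUnif.dagger A},
      RelUnif.IsProjectiveTo (RelUnif.Formula.NNILOver (RelUnif.parAtoms Var Par)) A,
      RelUnif.Extendible (RelUnif.parAtoms Var Par) A] := by
  tfae_have 1 → 2 := by
    rintro ⟨hθ, _, rfl, hA⟩
    obtain ⟨A', hA', h⟩ := RelUnif.exists_equivalent_dagger A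
    exact ⟨RelUnif.theta A l, hθ, A', hA', (RelUnif.lindSetoid _).trans hA h⟩
  tfae_have 2 → 3 := RelUnif.extendible_of_isProjectiveTo
  tfae_have 3 → 1 := RelUnif.theta_projects_dagger hl
  tfae_finish
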